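/- Let $X$ be a separable Banach space (over $\mathbb R$ or $\mathbb C$) that is not quasireflexive, i.e. the quotient $X^{**}/\pi(X)$ is infinite-dimensional, where $\pi : X \to X^{**}$ is the canonical embedding. For a subset $S \subset X^*$ let $S_{(1)}$ be the set of all limits of weak$^*$-convergent sequences of elements of $S$; put $S_{(0)} = S$ and, for every ordinal $\alpha > 0$, $$S_{(\alpha)} = \bigcup_{\beta < \alpha} \bigl(S_{(\beta)}\bigr)_{(1)}.$$ Then for every countable ordinal $\alpha$ there is a linear (not necessarily closed) subspace $\Gamma \subset X^*$ such that $$\Gamma_{(\alpha)} \neq \Gamma_{(\alpha+1)} = X^*.$$ -/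

import Mathlib

set_option maxSynthPendingDepth 3

open Topology Filter
open scoped Ordinal

/-- A normed space `X` is quasireflexive if the canonical image of `X` has finite codimension
in the bidual `X**`. -/
def Quasireflexive (𝕜 X : Type*) [RCLike 𝕜] [NormedAddCommGroup X] [NormedSpace 𝕜 X] : Prop :=
  Module.Finite 𝕜
    (StrongDual 𝕜 (StrongDual 𝕜 X) ⧸
      LinearMap.range (NormedSpace.inclusionInDoubleDual 𝕜 X).toLinearMap)

/-- The weak* derived set of `S ⊆ X*`: all limits of weak*-convergent sequences in `S`. -/
def weakStarDerived {𝕜 X : Type*} [RCLike 𝕜] [NormedAddCommGroup X] [NormedSpace 𝕜 X]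
    (S : Set (WeakDual 𝕜 X)) : Set (WeakDual 𝕜 X) :=
  {g | ∃ f : ℕ → WeakDual 𝕜 X, (∀ n, f n ∈ S) ∧ Tendsto f atTop (𝓝 g)}

/-- The weak* derived set of order `α`: it is `S` for `α = 0`, and the union of the weak* derived
sets of the derived sets of order `β`, over `β < α`, for `α > 0`. -/
noncomputable def weakStarDerivedOrder {𝕜 X : Type*} [RCLike 𝕜] [NormedAddCommGroup X]
    [NormedSpace 𝕜 X] (S : Set (WeakDual 𝕜 X)) (α : Ordinal.{0}) : Set (WeakDual 𝕜 X) :=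
  open Classical in
  if α = 0 then S else ⋃ β : Set.Iio α, weakStarDerived (weakStarDerivedOrder S β.1)
termination_by α
decreasing_by exact β.2

theorem weakStarDerivedOrder_zero {𝕜 X : Type*} [RCLike 𝕜] [NormedAddCommGroup X]
    [NormedSpace 𝕜 X] (S : Set (WeakDual 𝕜 X)) : weakStarDerivedOrder S 0 = S := by
  rw [weakStarDerivedOrder, if_pos rfl]

theorem weakStarDerivedOrder_of_ne_zero {𝕜 X : Type*} [RCLike 𝕜] [NormedAddCommGroup X]
    [NormedSpace 𝕜 X] (S : Set (WeakDual 𝕜 X)) {α : Ordinal.{0}} (hα : α ≠ 0) :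
    weakStarDerivedOrder S α =
      ⋃ β : Set.Iio α, weakStarDerived (weakStarDerivedOrder S β.1) := by
  rw [weakStarDerivedOrder, if_neg hα]

/-! Index by the tree of finite sequences vectors `e t` in `X` and bidual elements `f t`, where `f t
x` is the sum of `x` over the children of `t` whenever that series converges. Rank the tree with
root `α + 1`, and let `Γ` be cut out by the equations `x (e t) = c t * f t x` at nodes of nonzero
rank. Each `f t` need not be weak* continuous, so passing to limits may destroy equations, but only
slowly.

Lower bound: while the equations hold at almost all children of `t`, the weights `c` make the series
for `f t` uniformly dominated along a weak*-convergent sequence, so the equation at `t` survives.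
Hence members of `Γ_(β)` satisfy it at every node of rank above `β`
(`apply_eq_of_mem_weakStarDerivedOrder`).

Upper bound: adding a multiple of `g t m`, which is weak* null as `m → ∞`, repairs the equation at
`t` and disturbs only the child `m :: t`, of smaller rank. Induction puts finitely supported
functionals into `Γ_(β)` (`mem_weakStarDerivedOrder_of_finite_support`).

Non-quasireflexivity supplies infinitely many such independent series (`exists_biorthogonal_array`).
-/

/-! ### Helly's theorem -/

theorem exists_apply_eq_of_finiteDimensional {𝕜 V : Type*} [RCLike 𝕜] [NormedAddCommGroup V]
    [NormedSpace 𝕜 V] [FiniteDimensional 𝕜 V] (G : StrongDual 𝕜 (StrongDual 𝕜 V)) :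
    ∃ u : V, ‖u‖ ≤ ‖G‖ ∧ ∀ b : StrongDual 𝕜 V, b u = G b := by
  let G' : Module.Dual 𝕜 (Module.Dual 𝕜 V) :=
    G.toLinearMap ∘ₗ (LinearMap.toContinuousLinearMap : (V →ₗ[𝕜] 𝕜) ≃ₗ[𝕜] V →L[𝕜] 𝕜).toLinearMap
  have hG : ∀ b : StrongDual 𝕜 V, b ((Module.evalEquiv 𝕜 V).symm G') = G b := by
    intro b
    have h := Module.apply_evalEquiv_symm_apply 𝕜 V b.toLinearMap G'
    exact h
  refine ⟨(Module.evalEquiv 𝕜 V).symm G', ?_, hG⟩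
  refine NormedSpace.norm_le_dual_bound 𝕜 _ (norm_nonneg _) fun b => ?_
  rw [hG]
  exact G.le_opNorm b

/-- Helly's theorem: on finitely many functionals, an element of the bidual agrees with an element
of the space of almost the same norm. -/
theorem exists_apply_eq_of_finite {𝕜 E : Type*} [RCLike 𝕜] [NormedAddCommGroup E]
    [NormedSpace 𝕜 E] (F : StrongDual 𝕜 (StrongDual 𝕜 E)) {s : Set (StrongDual 𝕜 E)}
    (hs : s.Finite) : ∃ x : E, ‖x‖ ≤ ‖F‖ + 1 ∧ ∀ b ∈ s, b x = F b := by
  have := hs.to_subtype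
  let T : E →L[𝕜] (s → 𝕜) := ContinuousLinearMap.pi fun b => b.1
  -- Modulo the common kernel the space is finite-dimensional, hence reflexive; lifting from the
  -- quotient costs the extra 1 in the norm.
  let Y : Submodule 𝕜 E := T.ker
  have hY : IsClosed (Y : Set E) := T.isClosed_ker
  have : IsClosed (Y : Set E) := hY
  have : FiniteDimensional 𝕜 (E ⧸ Y) :=
    LinearEquiv.finiteDimensional (LinearMap.quotKerEquivRange T.toLinearMap).symm
  let q : E →L[𝕜] (E ⧸ Y) := Y.mkQL
  have hq : ‖q‖ ≤ 1 := by
    refine ContinuousLinearMap.opNorm_le_bound _ zero_le_one fun x => ?_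
    rw [one_mul]
    exact Submodule.Quotient.norm_mk_le Y x
  let P : StrongDual 𝕜 (E ⧸ Y) →L[𝕜] StrongDual 𝕜 E := ContinuousLinearMap.precomp 𝕜 q
  have hP : ‖P‖ ≤ 1 := by
    refine ContinuousLinearMap.opNorm_le_bound _ zero_le_one fun f => ?_
    rw [one_mul]
    refine (ContinuousLinearMap.opNorm_comp_le f q).trans ?_
    exact mul_le_of_le_one_right (norm_nonneg _) hq
  obtain ⟨u, hu, hub⟩ := exists_apply_eq_of_finiteDimensional (F.comp P)
  have huF : ‖u‖ ≤ ‖F‖ := hu.trans ((ContinuousLinearMap.opNorm_comp_le F P).trans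
    (mul_le_of_le_one_right (norm_nonneg _) hP))
  obtain ⟨x, rfl, hx⟩ := Submodule.Quotient.norm_mk_lt u zero_lt_one
  refine ⟨x, by linarith, fun b hb => ?_⟩
  have hle : Y ≤ b.ker := by
    intro y hy
    exact congrFun (show T y = 0 from hy) ⟨b, hb⟩
  let b' : (E ⧸ Y) →ₗ[𝕜] 𝕜 := Y.liftQ b.toLinearMap hle
  have h1 := hub (LinearMap.toContinuousLinearMap b')
  have h2 : P (LinearMap.toContinuousLinearMap b') = b := by
    ext y
    rfl
  have h3 : (F.comp P) (LinearMap.toContinuousLinearMap b') = F b := by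
    rw [ContinuousLinearMap.comp_apply, h2]
  rw [← h3, ← h1]
  rfl

/-! ### Biorthogonal systems modulo `X` -/

theorem exists_biorthogonal {𝕜 Q : Type*} [RCLike 𝕜] [NormedAddCommGroup Q] [NormedSpace 𝕜 Q]
    (hQ : ¬ FiniteDimensional 𝕜 Q) :
    ∃ (q : ℕ → Q) (f : ℕ → StrongDual 𝕜 Q), ∀ i j, f i (q j) = if i = j then 1 else 0 := by
  classical
  obtain ⟨p, hp, hr⟩ := exists_seq_of_forall_finset_exists
    (α := Q × StrongDual 𝕜 Q) (fun p => p.2 p.1 = 1)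
    (fun p p' => p.2 p'.1 = 0 ∧ p'.2 p.1 = 0) (by
      intro s _
      let K : Submodule 𝕜 Q := ⨅ p ∈ s, p.2.ker
      let S : Submodule 𝕜 Q := Submodule.span 𝕜 (Prod.fst '' (s : Set (Q × StrongDual 𝕜 Q)))
      have hS : FiniteDimensional 𝕜 S :=
        FiniteDimensional.span_of_finite 𝕜 (s.finite_toSet.image _)
      -- A finite-codimensional subspace cannot lie in a finite-dimensional one.
      obtain ⟨x, hxK, hxS⟩ : ∃ x ∈ K, x ∉ S := by
        by_contra! h
        apply hQ
        let T : Q →ₗ[𝕜] (s → 𝕜) := LinearMap.pi fun p => p.1.2.toLinearMap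
        have hker : T.ker ≤ S := by
          intro x hx
          refine h x ?_
          simp only [K, Submodule.mem_iInf]
          intro p hp
          exact congrFun (show T x = 0 from hx) ⟨p, hp⟩
        have h1 : FiniteDimensional 𝕜 T.ker := Submodule.finiteDimensional_of_le hker
        have h2 : FiniteDimensional 𝕜 (Q ⧸ T.ker) :=
          LinearEquiv.finiteDimensional (LinearMap.quotKerEquivRange T).symm
        exact Module.Finite.of_submodule_quotient T.ker
      have hcl : IsClosed (S : Set Q) := S.closed_of_finiteDimensional
      obtain ⟨g, hg⟩ : ∃ g : StrongDual 𝕜 (Q ⧸ S), g (S.mkQ x) ≠ 0 := by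
        by_contra! h
        have : IsClosed (S : Set Q) := hcl
        have h0 : S.mkQ x = 0 := SeparatingDual.eq_zero_of_forall_dual_eq_zero (R := 𝕜) h
        exact hxS ((Submodule.Quotient.mk_eq_zero S).1 h0)
      let f : StrongDual 𝕜 Q := (g (S.mkQ x))⁻¹ • g.comp S.mkQL
      refine ⟨(x, f), ?_, fun p hp => ⟨?_, ?_⟩⟩
      · exact inv_mul_cancel₀ hg
      · simp only [K, Submodule.mem_iInf] at hxK
        exact hxK p hp
      · have h0 : S.mkQL p.1 = 0 :=
          (Submodule.Quotient.mk_eq_zero S).2 (Submodule.subset_span ⟨p, hp, rfl⟩)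
        change (g (S.mkQ x))⁻¹ * g (S.mkQL p.1) = 0
        rw [h0, map_zero, mul_zero])
  refine ⟨fun n => (p n).1, fun n => (p n).2, fun i j => ?_⟩
  rcases lt_trichotomy i j with h | h | h
  · rw [if_neg h.ne]
    exact (hr i j h).1
  · rw [if_pos h, h]
    exact hp j
  · rw [if_neg h.ne']
    exact (hr j i h).2

theorem exists_bidual_biorthogonal {𝕜 X : Type*} [RCLike 𝕜] [NormedAddCommGroup X]
    [NormedSpace 𝕜 X] [CompleteSpace X] (hX : ¬ Quasireflexive 𝕜 X) :
    ∃ (F : ℕ → StrongDual 𝕜 (StrongDual 𝕜 X))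
      (Ψ : ℕ → StrongDual 𝕜 (StrongDual 𝕜 (StrongDual 𝕜 X))),
      (∀ i j, Ψ i (F j) = if i = j then 1 else 0) ∧
      ∀ i x, Ψ i (NormedSpace.inclusionInDoubleDual 𝕜 X x) = 0 := by
  let R := LinearMap.range (NormedSpace.inclusionInDoubleDual 𝕜 X).toLinearMap
  have hR : IsClosed (R : Set (StrongDual 𝕜 (StrongDual 𝕜 X))) :=
    (NormedSpace.inclusionInDoubleDualLi 𝕜 (E := X)).isometry.isClosedEmbedding.isClosed_range
  obtain ⟨q, f, hqf⟩ := exists_biorthogonal (𝕜 := 𝕜) (Q := StrongDual 𝕜 (StrongDual 𝕜 X) ⧸ R) hX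
  choose F hF using fun i => R.mkQ_surjective (q i)
  refine ⟨F, fun i => (f i).comp R.mkQL, fun i j => ?_, fun i x => ?_⟩
  · rw [← hqf i j, ← hF j]
    rfl
  · have h0 : R.mkQL (NormedSpace.inclusionInDoubleDual 𝕜 X x) = 0 :=
      (Submodule.Quotient.mk_eq_zero R).2 ⟨x, rfl⟩
    change f i (R.mkQL _) = 0
    rw [h0, map_zero]

/-! ### Weak* compactness and weak* null sequences -/

theorem exists_bidual_of_bounded_seq {𝕜 X : Type*} [RCLike 𝕜] [NormedAddCommGroup X]
    [NormedSpace 𝕜 X] {S : ℕ → X} {M : ℝ} (hS : ∀ k, ‖S k‖ ≤ M) :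
    ∃ F : StrongDual 𝕜 (StrongDual 𝕜 X), ∀ (x : StrongDual 𝕜 X) (l : 𝕜),
      Tendsto (fun k => x (S k)) atTop (𝓝 l) → F x = l := by
  let u : ℕ → WeakDual 𝕜 (StrongDual 𝕜 X) := fun k =>
    StrongDual.toWeakDual (NormedSpace.inclusionInDoubleDual 𝕜 X (S k))
  have hu : ∀ k, u k ∈ WeakDual.toStrongDual ⁻¹'
      Metric.closedBall (0 : StrongDual 𝕜 (StrongDual 𝕜 X)) M := by
    intro k
    rw [Set.mem_preimage, mem_closedBall_zero_iff]
    exact (NormedSpace.double_dual_bound 𝕜 X (S k)).trans (hS k)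
  obtain ⟨F, -, hF⟩ := (WeakDual.isCompact_closedBall
    (0 : StrongDual 𝕜 (StrongDual 𝕜 X)) M).ultrafilter_le_nhds'
      ((hyperfilter ℕ).map u) (Filter.mem_map.2 (Filter.univ_mem' hu))
  refine ⟨WeakDual.toStrongDual F, fun x l hl => ?_⟩
  have h1 : Tendsto u (hyperfilter ℕ : Filter ℕ) (𝓝 F) := hF
  have h2 := ((WeakDual.eval_continuous x).tendsto F).comp h1
  exact tendsto_nhds_unique h2 (hl.mono_left Nat.hyperfilter_le_atTop)

/-- Separability makes each dual ball weak* compact and metrizable; collect dense sequences of the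
balls of integer radius. -/
theorem exists_weakStar_seq_dense (𝕜 X : Type*) [RCLike 𝕜] [NormedAddCommGroup X]
    [NormedSpace 𝕜 X] [TopologicalSpace.SeparableSpace X] :
    ∃ φ : ℕ → WeakDual 𝕜 X, ∀ x : WeakDual 𝕜 X, ∃ k : ℕ → ℕ,
      Tendsto (fun n => φ (k n)) atTop (𝓝 x) := by
  let B : ℕ → Set (WeakDual 𝕜 X) := fun N =>
    WeakDual.toStrongDual ⁻¹' Metric.closedBall (0 : StrongDual 𝕜 X) N
  have hB : ∀ N, IsCompact (B N) := fun N => WeakDual.isCompact_closedBall (0 : StrongDual 𝕜 X) (N : ℝ)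
  have hd : ∀ N, ∃ d : ℕ → B N, DenseRange d ∧ TopologicalSpace.MetrizableSpace (B N) := by
    intro N
    have h1 := WeakDual.metrizable_of_isCompact 𝕜 X (B N) (hB N)
    have h2 : CompactSpace (B N) := isCompact_iff_compactSpace.1 (hB N)
    let _ := TopologicalSpace.metrizableSpaceMetric (B N)
    have h3 : Nonempty (B N) := ⟨⟨0, by simp [B]⟩⟩
    obtain ⟨d, hd⟩ := TopologicalSpace.exists_dense_seq (B N)
    exact ⟨d, hd, h1⟩
  choose d hd hm using hd
  let φ : ℕ × ℕ → WeakDual 𝕜 X := fun p => d p.1 p.2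
  refine ⟨fun n => φ n.unpair, fun x => ?_⟩
  obtain ⟨N, hN⟩ := exists_nat_ge ‖WeakDual.toStrongDual x‖
  have hx : x ∈ B N := by
    rw [Set.mem_preimage, mem_closedBall_zero_iff]
    exact hN
  have := hm N
  obtain ⟨y, hy, hyx⟩ := mem_closure_iff_seq_limit.1 (hd N ⟨x, hx⟩)
  choose k hk using hy
  refine ⟨fun n => Nat.pair N (k n), ?_⟩
  have h := (continuous_subtype_val.tendsto _).comp hyx
  refine h.congr fun n => ?_
  simp only [Nat.unpair_pair]
  exact congrArg Subtype.val (hk n).symm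

theorem tendsto_weakDual_zero_of_bounded {𝕜 X : Type*} [RCLike 𝕜] [NormedAddCommGroup X]
    [NormedSpace 𝕜 X] {g : ℕ → WeakDual 𝕜 X} {C : ℝ} {d : ℕ → X} (hd : DenseRange d)
    (hg : ∀ n, ‖WeakDual.toStrongDual (g n)‖ ≤ C) (h0 : ∀ l, ∀ᶠ n in atTop, g n (d l) = 0) :
    Tendsto g atTop (𝓝 0) := by
  have hC : 0 ≤ C := (norm_nonneg _).trans (hg 0)
  rw [tendsto_iff_forall_eval_tendsto_topDualPairing]
  intro x
  rw [Metric.tendsto_atTop]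
  intro ε hε
  obtain ⟨l, hl⟩ := hd.exists_dist_lt x (ε := ε / (C + 1)) (by positivity)
  obtain ⟨N, hN⟩ := eventually_atTop.1 (h0 l)
  refine ⟨N, fun n hn => ?_⟩
  have h1 : g n x = g n (x - d l) := by
    rw [map_sub, hN n hn, sub_zero]
  have h2 : ‖g n (x - d l)‖ ≤ C * ‖x - d l‖ :=
    ((WeakDual.toStrongDual (g n)).le_opNorm _).trans
      (mul_le_mul_of_nonneg_right (hg n) (norm_nonneg _))
  change dist (g n x) 0 < ε
  rw [dist_zero_right, h1]
  refine h2.trans_lt ?_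
  rw [dist_eq_norm] at hl
  calc C * ‖x - d l‖ ≤ C * (ε / (C + 1)) := by gcongr
    _ < (C + 1) * (ε / (C + 1)) := by
      have : 0 < ε / (C + 1) := by positivity
      nlinarith
    _ = ε := by field_simp

/-! ### The biorthogonal array in `X` -/

/-- At stage `k`, Helly's theorem yields `g k j` imitating `Ψ j` and then `s k i` imitating `F i` on
finite sets. Since `Ψ j` kills `X`, `g k j` vanishes on earlier `s`; on later ones it equals `F i (g
k j)`. So `g k j` sees a jump at stage `k`, and differences of consecutive `s` are biorthogonal to
the `g`. -/
theorem exists_biorthogonal_array {𝕜 X : Type*} [RCLike 𝕜] [NormedAddCommGroup X]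
    [NormedSpace 𝕜 X] [CompleteSpace X] [TopologicalSpace.SeparableSpace X]
    (hX : ¬ Quasireflexive 𝕜 X) :
    ∃ (E : ℕ → ℕ → X) (G : ℕ → ℕ → WeakDual 𝕜 X),
      (∀ i, ∃ M, ∀ k, ‖∑ r ∈ Finset.range k, E i r‖ ≤ M) ∧
      (∀ i r j k, G i r (E j k) = if i = j ∧ r = k then 1 else 0) ∧
      (∀ i, Tendsto (G i) atTop (𝓝 0)) ∧
      ∀ x : WeakDual 𝕜 X, ∃ y : ℕ → WeakDual 𝕜 X,
        (∀ n, {p : ℕ × ℕ | y n (E p.1 p.2) ≠ 0}.Finite) ∧ Tendsto y atTop (𝓝 x) := by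
  classical
  obtain ⟨F, Ψ, hΨF, hΨ⟩ := exists_bidual_biorthogonal hX
  obtain ⟨φ, hφ⟩ := exists_weakStar_seq_dense 𝕜 X
  obtain ⟨d, hd⟩ := TopologicalSpace.exists_dense_seq X
  obtain ⟨p, hp, hr⟩ := exists_seq_of_forall_finset_exists
    (α := ℕ × (ℕ → StrongDual 𝕜 X) × (ℕ → X))
    (fun p => (∀ j, ‖p.2.1 j‖ ≤ ‖Ψ j‖ + 1) ∧
      (∀ j, ∀ i ≤ p.1, F i (p.2.1 j) = if j = i then 1 else 0) ∧
      (∀ j, ∀ l ≤ p.1, p.2.1 j (d l) = 0) ∧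
      (∀ i, ‖p.2.2 i‖ ≤ ‖F i‖ + 1) ∧
      (∀ i, ∀ j ≤ p.1, p.2.1 j (p.2.2 i) = F i (p.2.1 j)) ∧
      (∀ i, ∀ l ≤ p.1, φ l (p.2.2 i) = F i (WeakDual.toStrongDual (φ l))))
    (fun p p' => p.1 < p'.1 ∧ (∀ j, ∀ i ≤ p.1, p'.2.1 j (p.2.2 i) = 0) ∧
      (∀ i, ∀ j ≤ p.1, p.2.1 j (p'.2.2 i) = F i (p.2.1 j))) (by
      intro s _
      let n := s.sup Prod.fst + 1
      have hn : ∀ p ∈ s, p.1 < n := fun p hp => Nat.lt_succ_of_le (Finset.le_sup (f := Prod.fst) hp)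
      let J := NormedSpace.inclusionInDoubleDual 𝕜 X
      have h1 : (F '' Set.Iic n ∪ ((J ∘ d) '' Set.Iic n ∪
          ⋃ p ∈ s, (fun i => J (p.2.2 i)) '' Set.Iic p.1)).Finite :=
        ((Set.finite_Iic n).image _).union (((Set.finite_Iic n).image _).union
          (s.finite_toSet.biUnion fun p _ => (Set.finite_Iic _).image _))
      choose g hgn hg using fun j => exists_apply_eq_of_finite (Ψ j) h1
      have h2 : (g '' Set.Iic n ∪ ((fun l => WeakDual.toStrongDual (φ l)) '' Set.Iic n ∪
          ⋃ p ∈ s, p.2.1 '' Set.Iic p.1)).Finite :=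
        ((Set.finite_Iic n).image _).union (((Set.finite_Iic n).image _).union
          (s.finite_toSet.biUnion fun p _ => (Set.finite_Iic _).image _))
      choose x hxn hx using fun i => exists_apply_eq_of_finite (F i) h2
      refine ⟨(n, g, x), ⟨hgn, fun j i hi => ?_, fun j l hl => ?_, hxn, fun i j hj => ?_,
        fun i l hl => ?_⟩, fun p hp => ⟨hn p hp, fun j i hi => ?_, fun i j hj => ?_⟩⟩
      · rw [hg j _ (Or.inl ⟨i, hi, rfl⟩), hΨF]
      · exact (hg j (J (d l)) (Or.inr (Or.inl ⟨l, hl, rfl⟩))).trans (hΨ j _)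
      · exact hx i _ (Or.inl ⟨j, hj, rfl⟩)
      · exact hx i (WeakDual.toStrongDual (φ l)) (Or.inr (Or.inl ⟨l, hl, rfl⟩))
      · refine (hg j (J (p.2.2 i)) (Or.inr (Or.inr ?_))).trans (hΨ j _)
        exact Set.mem_biUnion hp ⟨i, hi, rfl⟩
      · refine hx i _ (Or.inr (Or.inr ?_))
        exact Set.mem_biUnion hp ⟨j, hj, rfl⟩)
  have hmono : StrictMono fun k => (p k).1 := fun a b h => (hr a b h).1
  have hle : ∀ k, k ≤ (p k).1 := fun _ => hmono.le_apply
  obtain ⟨g, hg⟩ : ∃ g : ℕ → ℕ → StrongDual 𝕜 X, g = fun k => (p k).2.1 := ⟨_, rfl⟩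
  obtain ⟨s, hs⟩ : ∃ s : ℕ → ℕ → X, s = fun k => (p k).2.2 := ⟨_, rfl⟩
  have hgn : ∀ k j, ‖g k j‖ ≤ ‖Ψ j‖ + 1 := fun k => by subst hg; exact (hp k).1
  have hgF : ∀ k j, ∀ i ≤ k, F i (g k j) = if j = i then 1 else 0 := fun k j i hi => by
    subst hg; exact (hp k).2.1 j i (hi.trans (hle k))
  have hgd : ∀ k j, ∀ l ≤ k, g k j (d l) = 0 := fun k j l hl => by
    subst hg; exact (hp k).2.2.1 j l (hl.trans (hle k))
  have hsn : ∀ k i, ‖s k i‖ ≤ ‖F i‖ + 1 := fun k => by subst hs; exact (hp k).2.2.2.1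
  have hφs : ∀ k i, ∀ l ≤ k, φ l (s k i) = F i (WeakDual.toStrongDual (φ l)) := fun k i l hl => by
    subst hs; exact (hp k).2.2.2.2.2 i l (hl.trans (hle k))
  have hgs0 : ∀ k k', k < k' → ∀ j, ∀ i ≤ k, g k' j (s k i) = 0 := fun k k' h j i hi => by
    subst hg hs; exact (hr k k' h).2.1 j i (hi.trans (hle k))
  have hgs : ∀ k k', k ≤ k' → ∀ i, ∀ j ≤ k, g k j (s k' i) = F i (g k j) := by
    intro k k' h i j hj
    subst hg hs
    rcases h.lt_or_eq with h | rfl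
    · exact (hr k k' h).2.2 i j (hj.trans (hle k))
    · exact (hp k).2.2.2.2.1 i j (hj.trans (hle k))
  clear hr hp hmono hle
  -- Stage `k` controls only indices up to `k`, so row `i` starts at stage `i`.
  refine ⟨fun i r => s (i + r + 1) i - s (i + r) i,
    fun i r => StrongDual.toWeakDual (g (i + r + 1) i), fun i => ?_, fun i r j k => ?_, fun i => ?_,
    fun x => ?_⟩
  · refine ⟨(‖F i‖ + 1) + (‖F i‖ + 1), fun k => ?_⟩
    have h := Finset.sum_range_sub (fun r => s (i + r) i) k
    rw [show (∑ r ∈ Finset.range k, (s (i + r + 1) i - s (i + r) i)) =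
      s (i + k) i - s (i + 0) i from h]
    exact (norm_sub_le _ _).trans (add_le_add (hsn _ _) (hsn _ _))
  · change g (i + r + 1) i (s (j + k + 1) j - s (j + k) j) = _
    rw [map_sub]
    rcases lt_trichotomy (j + k) (i + r) with h | h | h
    · rw [hgs0 _ _ (by omega) _ _ (by omega), hgs0 _ _ (by omega) _ _ (by omega), sub_zero,
        if_neg (by omega)]
    · rw [hgs _ _ (by omega) _ _ (by omega), hgs0 _ _ (by omega) _ _ (by omega), sub_zero,
        hgF _ _ _ (by omega)]
      refine if_congr ?_ rfl rfl
      omega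
    · rw [hgs _ _ (by omega) _ _ (by omega), hgs _ _ (by omega) _ _ (by omega), sub_self,
        if_neg (by omega)]
  · refine tendsto_weakDual_zero_of_bounded hd (fun r => hgn (i + r + 1) i) fun l => ?_
    exact eventually_atTop.2 ⟨l, fun r hr => hgd _ _ _ (by omega)⟩
  · obtain ⟨k, hk⟩ := hφ x
    refine ⟨fun n => φ (k n), fun n => ?_, hk⟩
    refine ((Set.finite_Iio (k n)).prod (Set.finite_Iio (k n))).subset fun q hq => ?_
    by_contra h
    apply hq
    have h' : k n ≤ q.1 + q.2 := by
      simp only [Set.mem_prod, Set.mem_Iio] at h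
      omega
    rw [map_sub, hφs _ _ _ (by omega), hφs _ _ _ h', sub_self]

/-! ### Ranking the tree -/

theorem exists_rank_sequence {δ : Ordinal.{0}} (hδ : δ < ω₁) :
    ∃ d : ℕ → Ordinal.{0}, (∀ m, d m ≤ δ) ∧ (∀ m, d m ≠ 0 → ∃ ε, d m = ε + 1) ∧
      ∀ γ < δ, ∀ᶠ m in atTop, γ < d m := by
  rcases eq_or_ne δ 0 with rfl | h0
  · exact ⟨fun _ => 0, fun _ => le_rfl, fun _ h => absurd rfl h,
      fun γ hγ => absurd hγ not_lt_zero⟩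
  have hcount : Countable (Set.Iio δ) := by
    rw [← Cardinal.mk_le_aleph0_iff, Cardinal.mk_Iio_ordinal, Cardinal.lift_le_aleph0]
    rw [← Order.lt_succ_iff, Cardinal.succ_aleph0, ← Cardinal.lt_ord, Cardinal.ord_aleph]
    exact hδ
  have hne : Nonempty (Set.Iio δ) := ⟨⟨0, pos_iff_ne_zero.2 h0⟩⟩
  obtain ⟨a, ha⟩ := exists_surjective_nat (Set.Iio δ)
  let b : ℕ → Ordinal.{0} := fun n => (a n : Ordinal.{0})
  -- Successors of running maxima of an enumeration of the ordinals below `δ`.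
  refine ⟨fun m => (Finset.range (m + 1)).sup b + 1, fun m => ?_, fun m _ => ⟨_, rfl⟩,
    fun γ hγ => ?_⟩
  · refine Order.add_one_le_iff.2 ((Finset.sup_lt_iff (pos_iff_ne_zero.2 h0)).2 ?_)
    exact fun n _ => (a n).2
  · obtain ⟨n, hn⟩ := ha ⟨γ, hγ⟩
    refine eventually_atTop.2 ⟨n, fun m hm => ?_⟩
    refine Order.lt_add_one_iff.2 ?_
    have h1 : b n = γ := congrArg Subtype.val hn
    rw [← h1]
    exact Finset.le_sup (f := b) (Finset.mem_range.2 (by omega))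

/-- A ranking of the tree of finite sequences by zero and successor ordinals, in which the root has
rank `α + 1` and the ranks of the children of a node of rank `δ + 1` tend to `δ` from below. -/
theorem exists_tree_rank {α : Ordinal.{0}} (hα : α < ω₁) :
    ∃ ρ : List ℕ → Ordinal.{0}, ρ [] = α + 1 ∧ (∀ t, t ≠ [] → ρ t ≤ α) ∧
      ∀ t, ρ t ≠ 0 → ∃ δ, ρ t = δ + 1 ∧ (∀ m, ρ (m :: t) ≤ δ) ∧
        ∀ γ < δ, ∀ᶠ m in atTop, γ < ρ (m :: t) := by
  let S := {o : Ordinal.{0} // o < ω₁ ∧ (o ≠ 0 → ∃ ε, o = ε + 1)}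
  have hstep : ∀ o : S, ∃ d : ℕ → S, (∀ m, (d m).1 ≤ o.1) ∧ ∀ δ, o.1 = δ + 1 →
      (∀ m, (d m).1 ≤ δ) ∧ ∀ γ < δ, ∀ᶠ m in atTop, γ < (d m).1 := by
    rintro ⟨o, ho, ho'⟩
    rcases eq_or_ne o 0 with rfl | h0
    · exact ⟨fun _ => ⟨0, ho, ho'⟩, fun _ => le_rfl, fun δ hδ =>
        absurd hδ.symm (Order.lt_add_one_iff.2 (zero_le (a := δ))).ne'⟩
    obtain ⟨δ, rfl⟩ := ho' h0
    have hlt : δ < δ + 1 := Order.lt_add_one_iff.2 le_rfl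
    obtain ⟨d, hd1, hd2, hd3⟩ := exists_rank_sequence (hlt.trans ho)
    refine ⟨fun m => ⟨d m, (hd1 m).trans_lt (hlt.trans ho), hd2 m⟩,
      fun m => (hd1 m).trans hlt.le, fun δ' h => ?_⟩
    obtain rfl : δ = δ' := by simpa using h
    exact ⟨hd1, hd3⟩
  choose D hD1 hD2 using hstep
  have hα' : α + 1 < ω₁ := by
    rw [← Order.succ_eq_add_one]
    exact (Cardinal.isSuccLimit_omega 1).succ_lt hα
  let ρ : List ℕ → S := fun t => t.rec ⟨α + 1, hα', fun _ => ⟨α, rfl⟩⟩ fun m _ o => D o m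
  have hρ : ∀ m t, ρ (m :: t) = D (ρ t) m := fun _ _ => rfl
  refine ⟨fun t => (ρ t).1, rfl, fun t ht => ?_, fun t ht => ?_⟩
  · induction t with
    | nil => exact absurd rfl ht
    | cons m t ih =>
      rcases eq_or_ne t [] with rfl | h
      · exact (hD2 (ρ []) α rfl).1 m
      · exact (hD1 (ρ t) m).trans (ih h)
  · obtain ⟨δ, hδ⟩ := (ρ t).2.2 ht
    exact ⟨δ, hδ, hD2 (ρ t) δ hδ⟩

/-! ### Equations preserved and repaired in derived sets -/

section

variable {𝕜 X : Type*} [RCLike 𝕜] [NormedAddCommGroup X] [NormedSpace 𝕜 X]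

theorem weakStarDerived_subset_weakStarDerivedOrder (S : Set (WeakDual 𝕜 X))
    {γ β : Ordinal.{0}} (h : γ < β) :
    weakStarDerived (weakStarDerivedOrder S γ) ⊆ weakStarDerivedOrder S β := by
  rw [weakStarDerivedOrder_of_ne_zero S h.ne_bot]
  exact Set.subset_iUnion (fun β' : Set.Iio β => weakStarDerived (weakStarDerivedOrder S β'.1))
    ⟨γ, h⟩

theorem subset_weakStarDerivedOrder (S : Set (WeakDual 𝕜 X)) (β : Ordinal.{0}) :
    S ⊆ weakStarDerivedOrder S β := by
  rcases eq_or_ne β 0 with rfl | h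
  · rw [weakStarDerivedOrder_zero]
  · intro x hx
    refine weakStarDerived_subset_weakStarDerivedOrder S (pos_iff_ne_zero.2 h) ?_
    rw [weakStarDerivedOrder_zero]
    exact ⟨fun _ => x, fun _ => hx, tendsto_const_nhds⟩

theorem exists_norm_le_of_tendsto_weakDual [CompleteSpace X] {x : ℕ → WeakDual 𝕜 X}
    {y : WeakDual 𝕜 X} (h : Tendsto x atTop (𝓝 y)) :
    ∃ C, ∀ n, ‖WeakDual.toStrongDual (x n)‖ ≤ C := by
  refine banach_steinhaus (g := fun n => WeakDual.toStrongDual (x n)) fun v => ?_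
  have h1 : Tendsto (fun n => x n v) atTop (𝓝 (y v)) :=
    ((WeakDual.eval_continuous v).tendsto y).comp h
  obtain ⟨C, hC⟩ := (Metric.isBounded_range_of_tendsto _ h1).exists_norm_le
  exact ⟨C, fun n => hC _ ⟨n, rfl⟩⟩

variable {e : List ℕ → X} {f : List ℕ → StrongDual 𝕜 (StrongDual 𝕜 X)} {c : List ℕ → ℝ}
  {ρ : List ℕ → Ordinal.{0}} {Γ : Set (WeakDual 𝕜 X)}

theorem apply_eq_of_mem_weakStarDerivedOrder [CompleteSpace X]
    (hf : ∀ t (x : WeakDual 𝕜 X) (l : 𝕜),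
      Tendsto (fun k => ∑ r ∈ Finset.range k, x (e (r :: t))) atTop (𝓝 l) →
        f t (WeakDual.toStrongDual x) = l)
    (hc0 : ∀ t, 0 < c t) (hc : ∀ t m, c (m :: t) * ‖f (m :: t)‖ ≤ (1 / 2) ^ m)
    (hρ : ∀ t, ρ t ≠ 0 → ∃ δ, ρ t = δ + 1 ∧ ∀ γ < δ, ∀ᶠ m in atTop, γ < ρ (m :: t))
    (hΓ : ∀ x ∈ Γ, ∀ t, ρ t ≠ 0 → x (e t) = c t * f t (WeakDual.toStrongDual x))
    (β : Ordinal.{0}) : ∀ x ∈ weakStarDerivedOrder Γ β, ∀ t, β < ρ t →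
      x (e t) = c t * f t (WeakDual.toStrongDual x) := by
  induction β using WellFoundedLT.induction with
  | ind β ih =>
  intro x hx t ht
  rcases eq_or_ne β 0 with rfl | h0
  · rw [weakStarDerivedOrder_zero] at hx
    exact hΓ x hx t ht.ne'
  rw [weakStarDerivedOrder_of_ne_zero Γ h0, Set.mem_iUnion] at hx
  obtain ⟨⟨γ, hγ⟩, x', hx', hlim⟩ := hx
  obtain ⟨δ, hδ, hev⟩ := hρ t ht.ne_bot
  have hβδ : β ≤ δ := by
    rw [hδ] at ht
    exact Order.lt_add_one_iff.1 ht
  obtain ⟨m₀, hm₀⟩ := eventually_atTop.1 (hev γ (lt_of_lt_of_le hγ hβδ))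
  obtain ⟨C, hC⟩ := exists_norm_le_of_tendsto_weakDual hlim
  have hC0 : 0 ≤ C := (norm_nonneg _).trans (hC 0)
  have hpt : ∀ v, Tendsto (fun k => x' k v) atTop (𝓝 (x v)) := fun v =>
    ((WeakDual.eval_continuous v).tendsto x).comp hlim
  -- Children from `m₀` on have rank above `γ` and obey their equations, giving the geometric term;
  -- the finitely many others are bounded crudely.
  let bound : ℕ → ℝ := fun m => C * (1 / 2) ^ m + if m < m₀ then C * ‖e (m :: t)‖ else 0
  have hsum : Summable bound := by
    refine ((summable_geometric_two).mul_left C).add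
      (summable_of_ne_finset_zero (s := Finset.range m₀) fun m hm => ?_)
    rw [if_neg (by simpa using hm)]
  have hbound : ∀ k m, ‖x' k (e (m :: t))‖ ≤ bound m := by
    intro k m
    by_cases hm : m < m₀
    · simp only [bound, if_pos hm]
      have h1 := (WeakDual.toStrongDual (x' k)).le_of_opNorm_le (hC k) (e (m :: t))
      have h2 : 0 ≤ C * (1 / 2 : ℝ) ^ m := by positivity
      exact h1.trans (by linarith)
    · simp only [bound, if_neg hm, add_zero]
      rw [ih γ hγ (x' k) (hx' k) (m :: t) (hm₀ m (not_lt.1 hm)), norm_mul, RCLike.norm_ofReal,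
        abs_of_pos (hc0 _)]
      calc c (m :: t) * ‖f (m :: t) (WeakDual.toStrongDual (x' k))‖
          ≤ c (m :: t) * (‖f (m :: t)‖ * C) := by
            gcongr
            · exact (hc0 _).le
            · exact (f (m :: t)).le_opNorm_of_le (hC k)
        _ = (c (m :: t) * ‖f (m :: t)‖) * C := by ring
        _ ≤ (1 / 2) ^ m * C := by gcongr; exact hc t m
        _ = C * (1 / 2) ^ m := mul_comm _ _
  have hfx : ∀ z : WeakDual 𝕜 X, (∀ m, ‖z (e (m :: t))‖ ≤ bound m) →
      f t (WeakDual.toStrongDual z) = ∑' m, z (e (m :: t)) := fun z hz =>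
    hf t z _ (Summable.of_norm_bounded hsum hz).hasSum.tendsto_sum_nat
  have hfk : Tendsto (fun k => f t (WeakDual.toStrongDual (x' k))) atTop
      (𝓝 (f t (WeakDual.toStrongDual x))) := by
    rw [hfx x fun m => le_of_tendsto (hpt _).norm (Eventually.of_forall fun k => hbound k m)]
    simp_rw [fun k => hfx (x' k) (hbound k)]
    exact tendsto_tsum_of_dominated_convergence hsum (fun m => hpt _)
      (Eventually.of_forall fun k m => hbound k m)
  refine tendsto_nhds_unique (hpt (e t)) ?_
  simp_rw [fun k => ih γ hγ (x' k) (hx' k) t (lt_trans hγ ht)]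
  exact hfk.const_mul _

theorem mem_weakStarDerivedOrder_of_finite_support {g : List ℕ → ℕ → WeakDual 𝕜 X}
    (hf : ∀ t (x : WeakDual 𝕜 X) (l : 𝕜),
      Tendsto (fun k => ∑ r ∈ Finset.range k, x (e (r :: t))) atTop (𝓝 l) →
        f t (WeakDual.toStrongDual x) = l)
    (hc0 : ∀ t, 0 < c t)
    (hg : ∀ t m s, g t m (e s) = if s = m :: t then 1 else 0)
    (hfg : ∀ t s m, f t (WeakDual.toStrongDual (g s m)) = if t = s then 1 else 0)
    (hg0 : ∀ t, Tendsto (g t) atTop (𝓝 0))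
    (hρ : ∀ t, ρ t ≠ 0 → ∃ δ, ρ t = δ + 1 ∧ ∀ m, ρ (m :: t) ≤ δ)
    (hΓ : ∀ x, (∀ t, ρ t ≠ 0 → x (e t) = c t * f t (WeakDual.toStrongDual x)) → x ∈ Γ)
    (β : Ordinal.{0}) : ∀ y : WeakDual 𝕜 X, {t | y (e t) ≠ 0}.Finite →
      (∀ t, β < ρ t → y (e t) = c t * f t (WeakDual.toStrongDual y)) →
        y ∈ weakStarDerivedOrder Γ β := by
  classical
  induction β using WellFoundedLT.induction with
  | ind β ih =>
  intro y hfin hy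
  -- The equation at `t` is trivial unless `t` or one of its children is in the support of `y`.
  have hfin' : {t | ρ t ≠ 0 ∧ y (e t) ≠ c t * f t (WeakDual.toStrongDual y)}.Finite := by
    refine (hfin.union (hfin.image List.tail)).subset fun t ht => ?_
    by_contra hcon
    rw [Set.mem_union, not_or] at hcon
    have h1 : y (e t) = 0 := not_not.1 hcon.1
    have h2 : ∀ m, y (e (m :: t)) = 0 := fun m => by
      by_contra h
      exact hcon.2 ⟨m :: t, h, rfl⟩
    have h3 := hf t y 0 (by simp [h2])
    exact ht.2 (by rw [h1, h3, mul_zero])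
  obtain ⟨V, hV⟩ := hfin'.exists_finset
  rcases V.eq_empty_or_nonempty with rfl | hVne
  · refine subset_weakStarDerivedOrder Γ β (hΓ y fun t ht => ?_)
    by_contra h
    simpa using (hV t).2 ⟨ht, h⟩
  have hδ : ∀ t, ∃ δ, t ∈ V → ρ t = δ + 1 ∧ ∀ m, ρ (m :: t) ≤ δ := fun t => by
    by_cases ht : t ∈ V
    · obtain ⟨δ, h⟩ := hρ t ((hV t).1 ht).1
      exact ⟨δ, fun _ => h⟩
    · exact ⟨0, fun h => absurd h ht⟩
  choose δ hδ using hδ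
  have hδβ : ∀ t ∈ V, δ t < β := fun t ht => by
    have h1 : ρ t ≤ β := not_lt.1 fun h => ((hV t).1 ht).2 (hy t h)
    rw [(hδ t ht).1] at h1
    exact lt_of_lt_of_le (Order.lt_add_one_iff.2 le_rfl) h1
  obtain ⟨t₀, ht₀⟩ := hVne
  have hγ : V.sup δ < β := (Finset.sup_lt_iff (hδβ t₀ ht₀).bot_lt).2 hδβ
  have hVγ : ∀ t ∈ V, ∀ m, ρ (m :: t) ≤ V.sup δ := fun t ht m =>
    ((hδ t ht).2 m).trans (Finset.le_sup ht)
  -- The defect at `t` in units of `f t`: adding `a t • g t m` raises `f t` by exactly this.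
  let a : List ℕ → 𝕜 := fun t => y (e t) / c t - f t (WeakDual.toStrongDual y)
  have hye : ∀ m s, (y + ∑ t ∈ V, a t • g t m) (e s) =
      y (e s) + ∑ t ∈ V, a t * (if s = m :: t then 1 else 0) := fun m s => by
    have h : ∀ W : Finset (List ℕ), (∑ t ∈ W, a t • g t m : WeakDual 𝕜 X) (e s) =
        ∑ t ∈ W, a t * (if s = m :: t then 1 else 0) := fun W => by
      refine (map_sum (topDualPairing 𝕜 X |>.flip (e s)) _ _).trans ?_
      exact Finset.sum_congr rfl fun t _ => by rw [← hg]; rfl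
    rw [← h]
    rfl
  have hyf : ∀ m s, f s (WeakDual.toStrongDual (y + ∑ t ∈ V, a t • g t m)) =
      f s (WeakDual.toStrongDual y) + if s ∈ V then a s else 0 := fun m s => by
    simp only [map_add, map_sum, map_smul, hfg, smul_eq_mul, mul_ite, mul_one, mul_zero,
      Finset.sum_ite_eq]
  refine weakStarDerived_subset_weakStarDerivedOrder Γ hγ
    ⟨fun m => y + ∑ t ∈ V, a t • g t m, fun m => ih _ hγ _ ?_ fun s hs => ?_, ?_⟩
  · refine (hfin.union (V.finite_toSet.image (List.cons m))).subset fun s hs => ?_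
    by_contra hcon
    rw [Set.mem_union, not_or] at hcon
    apply hs
    rw [hye, not_not.1 hcon.1, zero_add]
    refine Finset.sum_eq_zero fun t ht => ?_
    rw [if_neg, mul_zero]
    rintro rfl
    exact hcon.2 ⟨t, ht, rfl⟩
  · have h1 : ∑ t ∈ V, a t * (if s = m :: t then 1 else 0) = 0 := by
      refine Finset.sum_eq_zero fun t ht => ?_
      rw [if_neg, mul_zero]
      rintro rfl
      exact hs.not_ge (hVγ t ht m)
    rw [hye, hyf, h1, add_zero]
    by_cases hsV : s ∈ V
    · have : (c s : 𝕜) ≠ 0 := RCLike.ofReal_ne_zero.2 (hc0 s).ne'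
      rw [if_pos hsV]
      simp only [a]
      field_simp
      ring
    · rw [if_neg hsV, add_zero]
      by_contra h
      exact hsV ((hV s).2 ⟨hs.ne_bot, h⟩)
  · have h : Tendsto (fun m => y + ∑ t ∈ V, a t • g t m) atTop (𝓝 (y + ∑ t ∈ V, a t • 0)) :=
      tendsto_const_nhds.add (tendsto_finsetSum _ fun t _ => (hg0 t).const_smul (a t))
    simpa using h

end

/-! ### The subspace `Γ` -/

theorem mainTheorem1 {𝕜 X : Type*} [RCLike 𝕜] [NormedAddCommGroup X] [NormedSpace 𝕜 X]
    [CompleteSpace X] [TopologicalSpace.SeparableSpace X] (hX : ¬ Quasireflexive 𝕜 X)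
    (α : Ordinal.{0}) (hα : α < ω₁) :
    ∃ Γ : Submodule 𝕜 (WeakDual 𝕜 X),
      weakStarDerivedOrder (Γ : Set (WeakDual 𝕜 X)) α ≠
        weakStarDerivedOrder (Γ : Set (WeakDual 𝕜 X)) (α + 1) ∧
      weakStarDerivedOrder (Γ : Set (WeakDual 𝕜 X)) (α + 1) = Set.univ := by
  obtain ⟨E, G, hE, hGE, hG0, hdense⟩ := exists_biorthogonal_array hX
  obtain ⟨ρ, hρ0, hρα, hρ⟩ := exists_tree_rank hα
  choose M hM using hE
  choose F hF using fun i => exists_bidual_of_bounded_seq (𝕜 := 𝕜) (hM i)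
  let code : List ℕ → ℕ := Encodable.encode
  have hcode : ∀ s t, code s = code t ↔ s = t := fun s t => Encodable.encode_inj
  -- The root is nobody's child, so its equation reduces to `f [] x = 0`, which `g [] 0` violates.
  let e : List ℕ → X := fun t => match t with
    | [] => 0
    | m :: t => E (code t) m
  let f : List ℕ → StrongDual 𝕜 (StrongDual 𝕜 X) := fun t => F (code t)
  let g : List ℕ → ℕ → WeakDual 𝕜 X := fun t => G (code t)
  let c : List ℕ → ℝ := fun t => (1 / 2) ^ t.headI / (‖f t‖ + 1)
  have hf : ∀ t (x : WeakDual 𝕜 X) (l : 𝕜),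
      Tendsto (fun k => ∑ r ∈ Finset.range k, x (e (r :: t))) atTop (𝓝 l) →
        f t (WeakDual.toStrongDual x) = l := fun t x l h => by
    refine hF (code t) (WeakDual.toStrongDual x) l (h.congr fun k => ?_)
    exact (map_sum x _ _).symm
  have hc0 : ∀ t, 0 < c t := fun t => by positivity
  have hc : ∀ t m, c (m :: t) * ‖f (m :: t)‖ ≤ (1 / 2) ^ m := fun t m => by
    change (1 / 2) ^ m / (‖f (m :: t)‖ + 1) * ‖f (m :: t)‖ ≤ (1 / 2 : ℝ) ^ m
    rw [div_mul_eq_mul_div, div_le_iff₀ (by positivity)]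
    gcongr
    linarith
  have hg : ∀ t m s, g t m (e s) = if s = m :: t then 1 else 0 := by
    rintro t m (_ | ⟨k, s⟩)
    · exact (map_zero (g t m)).trans (if_neg (by simp)).symm
    · refine (hGE _ _ _ _).trans (if_congr ?_ rfl rfl)
      rw [hcode, List.cons.injEq]
      exact ⟨fun h => ⟨h.2.symm, h.1.symm⟩, fun h => ⟨h.2.symm, h.1.symm⟩⟩
  have hfg : ∀ t s m, f t (WeakDual.toStrongDual (g s m)) = if t = s then 1 else 0 := by
    intro t s m
    refine hf t (g s m) _ (tendsto_const_nhds.congr' ?_)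
    filter_upwards [eventually_gt_atTop m] with k hk
    simp only [hg, List.cons.injEq]
    by_cases h : t = s
    · simp [h, hk]
    · simp [h]
  let h : List ℕ → WeakDual 𝕜 X →ₗ[𝕜] 𝕜 := fun t =>
    ((NormedSpace.inclusionInDoubleDual 𝕜 X (e t) - (c t : 𝕜) • f t).toLinearMap) ∘ₗ
      (WeakDual.toStrongDual : WeakDual 𝕜 X ≃ₗ[𝕜] StrongDual 𝕜 X).toLinearMap
  let Γ : Submodule 𝕜 (WeakDual 𝕜 X) := ⨅ t, ⨅ _ : ρ t ≠ 0, LinearMap.ker (h t)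
  have hΓ : ∀ x, x ∈ Γ ↔
      ∀ t, ρ t ≠ 0 → x (e t) = c t * f t (WeakDual.toStrongDual x) := fun x => by
    simp only [Γ, Submodule.mem_iInf]
    exact forall₂_congr fun t _ => sub_eq_zero
  have hlt : α < ρ [] := by
    rw [hρ0]
    exact Order.lt_add_one_iff.2 le_rfl
  have hne : g [] 0 ∉ weakStarDerivedOrder (Γ : Set (WeakDual 𝕜 X)) α := fun hmem => by
    have h1 := apply_eq_of_mem_weakStarDerivedOrder hf hc0 hc
      (fun t ht => (hρ t ht).imp fun δ h => ⟨h.1, h.2.2⟩) (fun x hx => (hΓ x).1 hx) α _ hmem [] hlt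
    have h2 := (hg [] 0 []).symm.trans h1
    rw [hfg, if_neg (by simp), if_pos rfl, mul_one] at h2
    exact (hc0 []).ne' (RCLike.ofReal_eq_zero.1 h2.symm)
  have huniv : weakStarDerivedOrder (Γ : Set (WeakDual 𝕜 X)) (α + 1) = Set.univ := by
    refine Set.eq_univ_of_forall fun x => ?_
    obtain ⟨y, hyfin, hyx⟩ := hdense x
    -- Only the root has rank above `α`; a weak* null correction enforces its equation.
    refine weakStarDerived_subset_weakStarDerivedOrder _ (Order.lt_add_one_iff.2 le_rfl)
      ⟨fun n => y n - f [] (WeakDual.toStrongDual (y n)) • g [] n, fun n => ?_, ?_⟩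
    · refine mem_weakStarDerivedOrder_of_finite_support hf hc0 hg hfg (fun t => hG0 (code t))
        (fun t ht => (hρ t ht).imp fun δ h => ⟨h.1, h.2.1⟩) (fun x hx => (hΓ x).2 hx) α _ ?_ ?_
      · have hinj : Set.InjOn (fun t : List ℕ => (code t.tail, t.headI)) {t | t ≠ []} := by
          rintro (_ | ⟨m, s⟩) hs (_ | ⟨k, t⟩) ht hst
          · rfl
          · exact absurd rfl hs
          · exact absurd rfl ht
          · simp only [List.tail_cons, List.headI_cons, Prod.mk.injEq, hcode] at hst
            rw [hst.1, hst.2]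
        have hfin : {t | y n (e t) ≠ 0}.Finite := by
          have hne : {t | y n (e t) ≠ 0} ⊆ {t | t ≠ []} := by
            rintro t ht rfl
            exact ht (map_zero (y n))
          refine Set.Finite.of_finite_image ((hyfin n).subset ?_) (hinj.mono hne)
          rintro _ ⟨t, ht, rfl⟩
          rcases t with _ | ⟨m, t⟩
          · exact absurd (map_zero (y n)) ht
          · exact ht
        refine (hfin.union (Set.finite_singleton [n])).subset fun t ht => ?_
        by_contra hcon
        rw [Set.mem_union, not_or] at hcon
        apply ht
        change y n (e t) - f [] (WeakDual.toStrongDual (y n)) * g [] n (e t) = 0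
        rw [not_not.1 hcon.1, hg, if_neg (show t ≠ [n] from hcon.2), mul_zero, sub_zero]
      · intro t ht
        obtain rfl : t = [] := by
          by_contra h
          exact ht.not_ge (hρα t h)
        rw [map_sub, map_sub, map_smul, map_smul, hfg, if_pos rfl, smul_eq_mul, mul_one, sub_self,
          mul_zero]
        exact map_zero _
    · obtain ⟨C, hC⟩ := exists_norm_le_of_tendsto_weakDual hyx
      have hz : Tendsto (fun n => f [] (WeakDual.toStrongDual (y n)) • g [] n) atTop (𝓝 0) := by
        rw [tendsto_iff_forall_eval_tendsto_topDualPairing]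
        intro v
        have hgv : Tendsto (fun n => g [] n v) atTop (𝓝 0) :=
          ((WeakDual.eval_continuous v).tendsto 0).comp (hG0 (code []))
        refine squeeze_zero_norm (a := fun n => (‖f []‖ * C) * ‖g [] n v‖) (fun n => ?_) ?_
        · refine (norm_mul_le _ _).trans ?_
          exact mul_le_mul_of_nonneg_right ((f []).le_opNorm_of_le (hC n)) (norm_nonneg _)
        · simpa using hgv.norm.const_mul (‖f []‖ * C)
      simpa using hyx.sub hz
  exact ⟨Γ, fun heq => hne (by rw [heq, huniv]; trivial), huniv⟩
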